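/- Let $\omega>0$ and $g>0$. The billiards table is the closed unit disc in $\mathbb{R}^2$ centered at the origin, rotating about its center with angular velocity $\omega$ (counterclockwise); its velocity at a point $x=(x_1,x_2)$ is $\omega Lx$, where $Lx=(-x_2,x_1)$. A pointlike particle moves in the disc. Between reflections its velocity $v(t)$, in non-rotating coordinates, satisfies $v'(t)=(0,-g)$. Its energy is $\|v(t)\|^2$. When it is at a point $q$ of the unit circle, its velocity in the rotating frame is $v-\omega Lq$ (in non-rotating axes). Whenever the particle hits the unit circle, at a point $q$ with velocity $v_-$, it is reflected: its new velocity is $$v_+=\omega Lq+\|v_--\omega Lq\|\,\bigl(\cos\theta\,(-q)+\sin\theta\, Lq\bigr),$$ so that the energy in the rotating frame is conserved and, in that frame, the new direction forms the angle $\theta$ with the inner normal $-q$. The angles of all reflections are independent random variables with the Lambertian law, i.e. with density $\frac12\cos\theta$ on $(-\pi/2,\pi/2)$. For $w>\omega^2$ and $p$ on the unit circle, the particle starting at $p$ with energy $w$ has, at time $0$, the velocity $v(0)$ with $\|v(0)\|^2=w$ whose direction in the rotating frame, i.e. the direction of $v(0)-\omega Lp$, is $\cos\theta\,(-p)+\sin\theta\,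 Lp$ for an angle $\theta$ that also has the Lambertian law and is independent of the reflection angles. For every $\omega>0$ and every $g>0$ there exist $w_0\in(\omega^2,\infty)$ and a point $p_1$ on the unit circle such that for every $w_1\in(w_0,\infty)$ there exists $\varepsilon>0$ such that the particle starting at $p_1$ with energy $w_0$ reaches an energy of at least $w_1$ at some time, after finitely many reflections, with probability greater than $\varepsilon$. -/

import Mathlib

open MeasureTheory

/-- The Euclidean plane, in the non-rotating (inertial) coordinate system; the second coordinate
is the vertical one. The billiards table is the closed unit disc. -/
abbrev Plane : Type := EuclideanSpace ℝ (Fin 2)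

/-- Rotation of the plane by the angle `π / 2` (counterclockwise). -/
def rotQuarter (x : Plane) : Plane := !₂[-x 1, x 0]

/-- The velocity at `x` of a table rotating about the origin with angular velocity `ω`.
A particle at `x` with velocity `v` has, in the rotating frame, the velocity
`v - tableVel ω x` (expressed in the inertial axes). -/
def tableVel (ω : ℝ) (x : Plane) : Plane := ω • rotQuarter x

/-- The gravitational acceleration: magnitude `g`, pointing vertically downwards. -/
def gravity (g : ℝ) : Plane := !₂[0, -g]

/-- Position, after time `t` of free flight, of a particle starting from `p` with velocity `v`. -/
noncomputable def flightPos (g : ℝ) (p v : Plane) (t : ℝ) : Plane :=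
  p + t • v + (t ^ 2 / 2) • gravity g

/-- Velocity, after time `t` of free flight, of a particle starting with velocity `v`. -/
def flightVel (g : ℝ) (v : Plane) (t : ℝ) : Plane := v + t • gravity g

/-- The duration of the flight of a particle which starts from the point `p` of the unit circle
with a velocity `v` pointing into the disc: the first positive time at which the free flight is
no longer in the open unit disc, that is, at which it is on the unit circle. -/
noncomputable def flightTime (g : ℝ) (p v : Plane) : ℝ :=
  sInf {t : ℝ | 0 < t ∧ 1 ≤ ‖flightPos g p v t‖}

/-- The unit vector at the point `p` of the unit circle which forms the angle `θ` with the inner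
normal `-p`; for `θ` in `(-π / 2, π / 2)` it points into the disc. -/
noncomputable def inwardDir (p : Plane) (θ : ℝ) : Plane :=
  Real.cos θ • (-p) + Real.sin θ • rotQuarter p

/-- The Lambertian law in dimension two, as the law of the angle with the inner normal: the density
with respect to arc length on the half circle is proportional to the scalar product with the
normal, with normalizing constant `1 / 2`. -/
noncomputable def lambertian : Measure ℝ :=
  (volume.restrict (Set.Ioo (-(Real.pi / 2)) (Real.pi / 2))).withDensity
    fun θ => ENNReal.ofReal (Real.cos θ / 2)

instance lambertian_isProbabilityMeasure : IsProbabilityMeasure lambertian := by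
  constructor
  have hle : -(Real.pi / 2) ≤ Real.pi / 2 := by linarith [Real.pi_pos]
  have hint : IntegrableOn (fun θ => Real.cos θ / 2)
      (Set.Ioo (-(Real.pi / 2)) (Real.pi / 2)) :=
    (((Real.continuous_cos.div_const 2).integrableOn_Icc).mono_set Set.Ioo_subset_Icc_self)
  rw [lambertian, withDensity_apply _ MeasurableSet.univ, Measure.restrict_univ,
    ← ofReal_integral_eq_lintegral_ofReal hint]
  · rw [← integral_Ioc_eq_integral_Ioo, ← intervalIntegral.integral_of_le hle]
    simp
  · refine (ae_restrict_iff' measurableSet_Ioo).2 (Filter.Eventually.of_forall fun θ hθ => ?_)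
    have := Real.cos_nonneg_of_mem_Icc ⟨hθ.1.le, hθ.2.le⟩
    simp only [Pi.zero_apply]
    positivity

/-- The velocity just after a reflection at the point `q` of the unit circle, if `v` is the velocity
just before it and `θ` is the angle of reflection in the rotating frame: the energy in the rotating
frame is conserved. -/
noncomputable def reflect (ω : ℝ) (q v : Plane) (θ : ℝ) : Plane :=
  tableVel ω q + ‖v - tableVel ω q‖ • inwardDir q θ

/-- The relative speed in `startVel`. -/
noncomputable def startSpeed (ω w θ : ℝ) : ℝ :=
  -(ω * Real.sin θ) + Real.sqrt (w - (ω * Real.cos θ) ^ 2)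

/-- The velocity of a particle which starts from the point `p` of the unit circle with energy `w`
and whose direction of motion in the rotating frame forms the angle `θ` with the inner normal.
It is characterized by `startVel_spec` and `startVel_unique`. -/
noncomputable def startVel (ω w : ℝ) (p : Plane) (θ : ℝ) : Plane :=
  tableVel ω p + startSpeed ω w θ • inwardDir p θ

/-- The position at a reflection (or starting) time and the velocity just after that time. -/
structure BilliardState where
  pos : Plane
  vel : Plane

/-- The state at the next reflection, which happens with reflection angle `θ`. -/
noncomputable def BilliardState.next (ω g : ℝ) (s : BilliardState) (θ : ℝ) : BilliardState :=
  let t := flightTime g s.pos s.vel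
  let q := flightPos g s.pos s.vel t
  ⟨q, reflect ω q (flightVel g s.vel t) θ⟩

/-- The trajectory with starting point `p` and starting energy `w`, as the sequence of states at
time `0` and at the consecutive reflections; `θ n` is the angle, measured in the rotating frame from
the inner normal, of the velocity just after time `0` (`n = 0`) or just after the `n`-th
reflection (`n ≥ 1`). -/
noncomputable def trajectory (ω g w : ℝ) (p : Plane) (θ : ℕ → ℝ) : ℕ → BilliardState
  | 0 => ⟨p, startVel ω w p (θ 0)⟩
  | n + 1 => (trajectory ω g w p θ n).next ω g (θ (n + 1))

/-- The event that the energy, i.e. the squared speed in the inertial frame, reaches the level `w₁`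
at some time, `t` being the time elapsed since the last reflection (the `n`-th one). -/
def attainsEnergy (ω g w : ℝ) (p : Plane) (w₁ : ℝ) : Set (ℕ → ℝ) :=
  {θ | ∃ n : ℕ, ∃ t : ℝ, 0 ≤ t ∧
    t ≤ flightTime g (trajectory ω g w p θ n).pos (trajectory ω g w p θ n).vel ∧
    w₁ ≤ ‖flightVel g (trajectory ω g w p θ n).vel t‖ ^ 2}

/-- The law of the angles of a trajectory with Lambertian reflections: they are independent and
each of them has the Lambertian law. -/
noncomputable def lambertianAngles : Measure (ℕ → ℝ) :=
  Measure.infinitePi fun _ : ℕ => lambertian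

theorem norm_tableVel_add_smul_inwardDir_sq (ω r : ℝ) {p : Plane} (hp : ‖p‖ = 1) (θ : ℝ) :
    ‖tableVel ω p + r • inwardDir p θ‖ ^ 2 = ω ^ 2 + 2 * ω * r * Real.sin θ + r ^ 2 := by
  have h : p 0 ^ 2 + p 1 ^ 2 = 1 := by
    have h1 := EuclideanSpace.norm_sq_eq p
    rw [hp] at h1
    simpa [Fin.sum_univ_two] using h1.symm
  have h2 := Real.sin_sq_add_cos_sq θ
  rw [EuclideanSpace.norm_sq_eq]
  simp only [tableVel, inwardDir, rotQuarter, Fin.sum_univ_two, Real.norm_eq_abs, sq_abs,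
    PiLp.add_apply, PiLp.smul_apply, PiLp.neg_apply, smul_eq_mul, Matrix.cons_val_zero,
    Matrix.cons_val_one]
  linear_combination (ω ^ 2 + 2 * ω * r * Real.sin θ +
    r ^ 2 * (Real.sin θ ^ 2 + Real.cos θ ^ 2)) * h + r ^ 2 * h2

/-- A particle started with `startVel ω w p θ` has energy `w`, and its velocity in the rotating frame
is a positive multiple of `inwardDir p θ`. -/
theorem startVel_spec {ω w : ℝ} (hw : ω ^ 2 < w) {p : Plane} (hp : ‖p‖ = 1) (θ : ℝ) :
    ‖startVel ω w p θ‖ ^ 2 = w ∧ 0 < startSpeed ω w θ ∧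
      startVel ω w p θ - tableVel ω p = startSpeed ω w θ • inwardDir p θ := by
  have h2 := Real.sin_sq_add_cos_sq θ
  have h3 : (ω * Real.sin θ) ^ 2 < w - (ω * Real.cos θ) ^ 2 := by
    have : (ω * Real.sin θ) ^ 2 + (ω * Real.cos θ) ^ 2 = ω ^ 2 := by
      linear_combination ω ^ 2 * h2
    linarith
  have h4 := Real.sq_sqrt ((sq_nonneg _).trans h3.le)
  refine ⟨?_, ?_, ?_⟩
  · rw [startVel, norm_tableVel_add_smul_inwardDir_sq _ _ hp, startSpeed]
    linear_combination h4 - ω ^ 2 * h2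
  · have := Real.lt_sqrt_of_sq_lt h3
    rw [startSpeed]
    linarith
  · rw [startVel, add_sub_cancel_left]

/-- `startVel ω w p θ` is the only velocity with the properties of `startVel_spec`. -/
theorem startVel_unique {ω w : ℝ} (hw : ω ^ 2 < w) {p : Plane} (hp : ‖p‖ = 1) (θ : ℝ)
    {v : Plane} {r : ℝ} (hr : 0 < r) (hv : v - tableVel ω p = r • inwardDir p θ)
    (hvw : ‖v‖ ^ 2 = w) : v = startVel ω w p θ := by
  obtain ⟨h1, h2, -⟩ := startVel_spec hw hp θ
  obtain rfl : v = tableVel ω p + r • inwardDir p θ := by rw [← hv]; abel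
  rw [norm_tableVel_add_smul_inwardDir_sq _ _ hp] at hvw
  rw [startVel, norm_tableVel_add_smul_inwardDir_sq _ _ hp] at h1
  set s := startSpeed ω w θ with hs
  have h5 : (r - s) * (2 * ω * Real.sin θ + r + s) = 0 := by
    linear_combination hvw - h1
  have h6 : 0 < 2 * ω * Real.sin θ + r + s := by
    have e : 0 < r * (2 * ω * Real.sin θ + r) := by nlinarith
    have := (mul_pos_iff_of_pos_left hr).1 e
    linarith
  have h7 : r = s := by
    rcases mul_eq_zero.1 h5 with h | h
    · linarith
    · linarith
  rw [startVel, ← hs, h7]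

/-!
The energy is pumped up along an explicit orbit which bounces for ever on the vertical chord of the
disc with abscissa `3 / 5`. At the ends `(3 / 5, ±4 / 5)` of this chord the table moves upwards with
velocity `3 ω / 5`. A particle arriving there vertically can leave vertically again: for a suitable
angle of reflection the collision is an elastic bounce on a wall moving upwards with that velocity
(`VerticalOrbit.exists_reflect_eq`). With `K = 6 ω / 5`, the bounce at the upper end lowers the speed
by `K` and the one at the lower end raises it by `K`. Because of gravity the loss happens at lower
speed than the gain, and `x ↦ √(x ^ 2 + C)`, which gives the speed at the lower end in terms of that
at the upper one, is a strict contraction; so every round trip increases the speed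
(`lt_roundTrip`). The speed has no finite limit, since the limit would be a fixed point
(`tendsto_iterate_roundTrip`).

This orbit itself has probability zero, but it crosses the unit circle transversally, so that the
time of the next collision (`tendsto_flightTime`), and inductively each state of the trajectory
(`VerticalOrbit.tendsto_trajectory`), is continuous in the angles at the angles of the orbit. The
event of attaining a given energy therefore contains a neighbourhood of this sequence of angles in
the product topology. Such a neighbourhood restricts only finitely many angles, each of them to an
open set which meets `(-π / 2, π / 2)`, and so has positive probability
(`lambertianAngles_pos_of_mem_nhds`).
-/

/-! ### First exit times -/

open Filter Topology in
/-- A continuous function which is negative at `0` and nonnegative somewhere on the right vanishes at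
the first positive time at which it is nonnegative. -/
theorem eq_zero_at_sInf_nonneg {h : ℝ → ℝ} (hh : Continuous h) (h0 : h 0 < 0)
    {t₁ : ℝ} (ht₁ : 0 < t₁) (h1 : 0 ≤ h t₁) :
    h (sInf {t : ℝ | 0 < t ∧ 0 ≤ h t}) = 0 := by
  have hset : {t : ℝ | 0 < t ∧ 0 ≤ h t} = {t : ℝ | 0 ≤ t ∧ 0 ≤ h t} := by
    ext t
    refine ⟨fun ht => ⟨ht.1.le, ht.2⟩, fun ht => ⟨lt_of_le_of_ne ht.1 ?_, ht.2⟩⟩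
    rintro rfl
    exact absurd ht.2 (not_le.2 h0)
  have hbdd : BddBelow {t : ℝ | 0 < t ∧ 0 ≤ h t} := ⟨0, fun t ht => ht.1.le⟩
  have hcl : IsClosed {t : ℝ | 0 < t ∧ 0 ≤ h t} := by
    rw [hset]
    exact (isClosed_le continuous_const continuous_id).inter (isClosed_le continuous_const hh)
  have hmem := hcl.csInf_mem ⟨t₁, ht₁, h1⟩ hbdd
  obtain ⟨c, hc, hc0⟩ := intermediate_value_Icc hmem.1.le hh.continuousOn ⟨h0.le, hmem.2⟩
  have hcpos : 0 < c := lt_of_le_of_ne hc.1 (by rintro rfl; exact absurd hc0 h0.ne)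
  have := csInf_le hbdd (show c ∈ {t : ℝ | 0 < t ∧ 0 ≤ h t} from ⟨hcpos, hc0.ge⟩)
  rw [le_antisymm this hc.2, hc0]

open Filter Topology in
/-- The first positive time at which `h x` is nonnegative depends continuously on the parameter `x`
at each `x₀` for which `h x₀` takes positive values immediately after its first zero `T`. -/
theorem tendsto_sInf_nonneg {X : Type*} [TopologicalSpace X] {h : X → ℝ → ℝ}
    (hh : Continuous (Function.uncurry h)) {x₀ : X} {T : ℝ} (hT : 0 < T)
    (hneg : ∀ t, 0 ≤ t → t < T → h x₀ t < 0) (hpos : ∀ᶠ t in 𝓝[>] T, 0 < h x₀ t) :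
    Tendsto (fun x => sInf {t : ℝ | 0 < t ∧ 0 ≤ h x t}) (𝓝 x₀) (𝓝 T) ∧
      ∀ᶠ x in 𝓝 x₀, h x (sInf {t : ℝ | 0 < t ∧ 0 ≤ h x t}) = 0 := by
  have hx : ∀ t, Continuous fun x => h x t := fun t =>
    hh.comp (continuous_id.prodMk continuous_const)
  have ht : ∀ x, Continuous (h x) := fun x => hh.comp (continuous_const.prodMk continuous_id)
  have hbdd : ∀ x, BddBelow {t : ℝ | 0 < t ∧ 0 ≤ h x t} := fun x => ⟨0, fun t ht => ht.1.le⟩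
  have hup : ∀ u, T < u → ∃ t, T < t ∧ t < u ∧ ∀ᶠ x in 𝓝 x₀, 0 < h x t := by
    intro u hu
    obtain ⟨t, ht, htu⟩ := (hpos.and (Ioo_mem_nhdsGT hu)).exists
    exact ⟨t, htu.1, htu.2, (hx t).continuousAt.eventually (lt_mem_nhds ht)⟩
  refine ⟨tendsto_order.2 ⟨fun l hl => ?_, fun u hu => ?_⟩, ?_⟩
  · obtain ⟨l', hl', hl'T⟩ := exists_between (max_lt hl hT)
    have hneg' : ∀ᶠ x in 𝓝 x₀, ∀ t ∈ Set.Icc 0 l', h x t < 0 := by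
      refine isCompact_Icc.eventually_forall_of_forall_eventually fun t htm => ?_
      exact hh.continuousAt.eventually (gt_mem_nhds (hneg t htm.1 (htm.2.trans_lt hl'T)))
    obtain ⟨t, hTt, -, hev⟩ := hup (T + 1) (by linarith)
    filter_upwards [hneg', hev] with x hx1 hx2
    refine (lt_of_le_of_lt (le_max_left l 0) hl').trans_le
      (le_csInf ⟨t, hT.trans hTt, hx2.le⟩ fun s hs => ?_)
    by_contra! hlt
    exact absurd hs.2 (not_le.2 (hx1 s ⟨hs.1.le, hlt.le⟩))
  · obtain ⟨t, hTt, htu, hev⟩ := hup u hu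
    filter_upwards [hev] with x hx1
    exact (csInf_le (hbdd x) ⟨hT.trans hTt, hx1.le⟩).trans_lt htu
  · obtain ⟨t, hTt, -, hev⟩ := hup (T + 1) (by linarith)
    filter_upwards [hev, (hx 0).continuousAt.eventually (gt_mem_nhds (hneg 0 le_rfl hT))]
      with x hx1 hx2
    exact eq_zero_at_sInf_nonneg (ht x) hx2 (hT.trans hTt) hx1.le

/-! ### Free flights -/

theorem plane_norm_sq (x : Plane) : ‖x‖ ^ 2 = x 0 ^ 2 + x 1 ^ 2 := by
  simp [EuclideanSpace.norm_sq_eq, Fin.sum_univ_two]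

/-- The polynomial `(‖flightPos g p v t‖ ^ 2 - 1) / t`, for `p` on the unit circle. Unlike the
squared norm itself it does not vanish at the starting time, which makes it suitable for locating
the next collision. -/
noncomputable def exitFun (g : ℝ) (x : Plane × Plane) (t : ℝ) : ℝ :=
  2 * (x.1 0 * x.2 0 + x.1 1 * x.2 1) + t * (x.2 0 ^ 2 + x.2 1 ^ 2 - g * x.1 1)
    - g * t ^ 2 * x.2 1 + g ^ 2 * t ^ 3 / 4

theorem continuous_exitFun (g : ℝ) : Continuous (Function.uncurry (exitFun g)) := by
  unfold exitFun Function.uncurry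
  fun_prop

theorem norm_flightPos_sq (g : ℝ) {p : Plane} (hp : ‖p‖ = 1) (v : Plane) (t : ℝ) :
    ‖flightPos g p v t‖ ^ 2 = 1 + t * exitFun g (p, v) t := by
  have h := plane_norm_sq p
  rw [hp] at h
  rw [plane_norm_sq]
  simp only [flightPos, gravity, exitFun, PiLp.add_apply, PiLp.smul_apply, smul_eq_mul,
    Matrix.cons_val_zero, Matrix.cons_val_one]
  linear_combination -h

theorem flightTime_eq_sInf_exitFun (g : ℝ) {p : Plane} (hp : ‖p‖ = 1) (v : Plane) :
    flightTime g p v = sInf {t : ℝ | 0 < t ∧ 0 ≤ exitFun g (p, v) t} := by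
  unfold flightTime
  congr 1
  ext t
  refine and_congr_right fun ht => ?_
  rw [← mul_nonneg_iff_of_pos_left ht, ← one_le_sq_iff₀ (norm_nonneg _), norm_flightPos_sq g hp]
  constructor <;> intro h <;> linarith

open Filter Topology in
/-- Continuity of the collision time, for flights starting on the unit circle, at a flight which
leaves the disc transversally. -/
theorem tendsto_flightTime {g : ℝ} {x₀ : Plane × Plane} {T : ℝ} (hT : 0 < T)
    (hneg : ∀ t, 0 ≤ t → t < T → exitFun g x₀ t < 0) (hpos : ∀ᶠ t in 𝓝[>] T, 0 < exitFun g x₀ t)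
    {X : Type*} {l : Filter X} {p v : X → Plane}
    (hpv : Tendsto (fun x => (p x, v x)) l (𝓝 x₀)) (hp : ∀ᶠ x in l, ‖p x‖ = 1) :
    Tendsto (fun x => flightTime g (p x) (v x)) l (𝓝 T) ∧
      ∀ᶠ x in l, ‖flightPos g (p x) (v x) (flightTime g (p x) (v x))‖ = 1 := by
  obtain ⟨h1, h2⟩ := tendsto_sInf_nonneg (continuous_exitFun g) hT hneg hpos
  constructor
  · refine (h1.comp hpv).congr' ?_
    filter_upwards [hp] with x hx
    rw [flightTime_eq_sInf_exitFun g hx, Function.comp_apply]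
  · filter_upwards [hp, hpv.eventually h2] with x hx hx2
    rw [← flightTime_eq_sInf_exitFun g hx] at hx2
    rw [← sq_eq_sq₀ (norm_nonneg _) zero_le_one, norm_flightPos_sq g hx, hx2]
    ring

/-- On a vertical chord the exit polynomial splits into linear factors; `c` and `d` are the vertical
velocities at the two ends, related by conservation of energy. -/
theorem exitFun_vertical {g : ℝ} (hg : 0 < g) {a b c d : ℝ} (hd : d ^ 2 = c ^ 2 + 4 * g * b)
    (t : ℝ) : exitFun g (!₂[a, b], !₂[0, c]) t =
      (2 * c - g * t) * (c + d - g * t) * (g * t - (c - d)) / (4 * g) := by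
  have hb : b = (d ^ 2 - c ^ 2) / (4 * g) := by field_simp; linarith
  simp only [exitFun, Matrix.cons_val_zero, Matrix.cons_val_one, hb]
  field_simp
  ring

/-- `(c - d) / g` is the time of flight along the chord from height `b` to height `-b`, when `c` and
`d` are the vertical velocities at its ends (see `flightPos_vertical`). -/
theorem vertical_time_pos {g : ℝ} (hg : 0 < g) {b c d : ℝ} (hd : d ^ 2 = c ^ 2 + 4 * g * b)
    (hbc : b * c < 0) (hcd : 0 < c * d) : 0 < (c - d) / g := by
  refine div_pos ?_ hg
  have h1 : (c - d) * (c + d) * c = 4 * g * (-(b * c)) := by linear_combination -c * hd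
  have h2 : 0 < (c - d) * ((c + d) * c) := by
    rw [← mul_assoc, h1]
    have := neg_pos.2 hbc
    positivity
  exact pos_of_mul_pos_left h2 (by nlinarith [sq_nonneg c])

/-- Until some time after the collision, the sign of `exitFun_vertical` is that of its factor which
vanishes at the collision: the zeros of the other two come later, or are negative. -/
theorem vertical_factors_pos {g : ℝ} (hg : 0 < g) {c d t : ℝ} (hcd : 0 < c * d)
    (hT : 0 < (c - d) / g) (ht : 0 ≤ t) (htT : g * t < c - d + |d|) :
    0 < (2 * c - g * t) * (c + d - g * t) := by
  have hgt : 0 ≤ g * t := by positivity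
  have hcd' : 0 < c - d := (div_pos_iff_of_pos_right hg).1 hT
  rcases pos_and_pos_or_neg_and_neg_of_mul_pos hcd with ⟨hc, hd⟩ | ⟨hc, hd⟩
  · rw [abs_of_pos hd] at htT
    apply mul_pos <;> linarith
  · apply mul_pos_of_neg_of_neg <;> linarith

theorem exitFun_vertical_neg {g : ℝ} (hg : 0 < g) {a b c d : ℝ} (hd : d ^ 2 = c ^ 2 + 4 * g * b)
    (hbc : b * c < 0) (hcd : 0 < c * d) (t : ℝ) (ht : 0 ≤ t) (htT : t < (c - d) / g) :
    exitFun g (!₂[a, b], !₂[0, c]) t < 0 := by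
  have htT' : g * t < c - d := by rwa [lt_div_iff₀ hg, mul_comm] at htT
  rw [exitFun_vertical hg hd]
  refine div_neg_of_neg_of_pos (mul_neg_of_pos_of_neg (vertical_factors_pos hg hcd
    (vertical_time_pos hg hd hbc hcd) ht (by linarith [abs_nonneg d])) (by linarith)) (by positivity)

open Filter Topology in
theorem exitFun_vertical_pos {g : ℝ} (hg : 0 < g) {a b c d : ℝ} (hd : d ^ 2 = c ^ 2 + 4 * g * b)
    (hbc : b * c < 0) (hcd : 0 < c * d) :
    ∀ᶠ t in 𝓝[>] ((c - d) / g), 0 < exitFun g (!₂[a, b], !₂[0, c]) t := by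
  have hT := vertical_time_pos hg hd hbc hcd
  have hlt : (c - d) / g < (c - d + |d|) / g := by
    gcongr
    linarith [abs_pos.2 (right_ne_zero_of_mul hcd.ne')]
  filter_upwards [Ioo_mem_nhdsGT hlt] with t ht
  have h1 : c - d < g * t := by have := ht.1; rwa [div_lt_iff₀ hg, mul_comm] at this
  have h2 : g * t < c - d + |d| := by have := ht.2; rwa [lt_div_iff₀ hg, mul_comm] at this
  rw [exitFun_vertical hg hd]
  exact div_pos (mul_pos (vertical_factors_pos hg hcd hT (hT.trans ht.1).le h2) (by linarith))
    (by positivity)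

theorem flightPos_vertical {g : ℝ} (hg : 0 < g) {a b c d : ℝ} (hd : d ^ 2 = c ^ 2 + 4 * g * b) :
    flightPos g !₂[a, b] !₂[0, c] ((c - d) / g) = !₂[a, -b] := by
  ext i
  fin_cases i
  · simp [flightPos, gravity]
  · have hb : b = (d ^ 2 - c ^ 2) / (4 * g) := by field_simp; linarith
    simp [flightPos, gravity, hb]
    field_simp
    ring

theorem flightVel_vertical {g : ℝ} (hg : 0 < g) (c d : ℝ) :
    flightVel g !₂[0, c] ((c - d) / g) = !₂[0, d] := by
  ext i
  fin_cases i
  · simp [flightVel, gravity]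
  · simp [flightVel, gravity]
    field_simp
    ring

/-! ### Prescribing the direction after a reflection -/

/-- Every velocity pointing into the disc is obtained, in the rotating frame, from some angle with
the inner normal. -/
theorem exists_angle {ω : ℝ} {p v : Plane} (hp : ‖p‖ = 1) (hv : p 0 * v 0 + p 1 * v 1 < 0) :
    0 < ‖v - tableVel ω p‖ ∧ ∃ φ ∈ Set.Ioo (-(Real.pi / 2)) (Real.pi / 2),
      v - tableVel ω p = ‖v - tableVel ω p‖ • inwardDir p φ := by
  have hp2 := plane_norm_sq p
  rw [hp] at hp2
  set u := v - tableVel ω p with hu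
  set r := ‖u‖ with hr
  have hu0 : u 0 = v 0 + ω * p 1 := by simp [hu, tableVel, rotQuarter]
  have hu1 : u 1 = v 1 - ω * p 0 := by simp [hu, tableVel, rotQuarter]
  have hrs : r ^ 2 = u 0 ^ 2 + u 1 ^ 2 := plane_norm_sq u
  -- `n` and `τ` are the components of `u` along the inner normal and along the circle
  obtain ⟨n, hn⟩ : ∃ n, n = -(p 0 * u 0 + p 1 * u 1) := ⟨_, rfl⟩
  obtain ⟨τ, hτ⟩ : ∃ τ, τ = p 0 * u 1 - p 1 * u 0 := ⟨_, rfl⟩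
  have hnpos : 0 < n := by
    rw [hn, hu0, hu1]
    linarith
  have hsum : n ^ 2 + τ ^ 2 = r ^ 2 := by
    rw [hn, hτ, hrs]
    linear_combination -(u 0 ^ 2 + u 1 ^ 2) * hp2
  have hrpos : 0 < r := by
    refine lt_of_le_of_ne (norm_nonneg u) fun h => ?_
    rw [← h] at hsum
    nlinarith [sq_nonneg τ, sq_pos_of_pos hnpos]
  have hlt : |τ / r| < 1 := by
    rw [← sq_lt_one_iff_abs_lt_one, div_pow, div_lt_one (by positivity)]
    nlinarith [sq_pos_of_pos hnpos]
  refine ⟨hrpos, Real.arcsin (τ / r), ⟨Real.neg_pi_div_two_lt_arcsin.2 (abs_lt.1 hlt).1,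
    Real.arcsin_lt_pi_div_two.2 (abs_lt.1 hlt).2⟩, ?_⟩
  have hsin : Real.sin (Real.arcsin (τ / r)) = τ / r :=
    Real.sin_arcsin (abs_lt.1 hlt).1.le (abs_lt.1 hlt).2.le
  have hcos : Real.cos (Real.arcsin (τ / r)) = n / r := by
    rw [Real.cos_arcsin, Real.sqrt_eq_iff_mul_self_eq_of_pos (by positivity)]
    field_simp
    linarith
  ext i
  fin_cases i
  · simp [inwardDir, rotQuarter, hsin, hcos]
    field_simp
    rw [hn, hτ]
    linear_combination u 0 * hp2
  · simp [inwardDir, rotQuarter, hsin, hcos]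
    field_simp
    rw [hn, hτ]
    linear_combination u 1 * hp2

/-! ### Continuity of the trajectory in the angles -/

theorem continuous_rotQuarter : Continuous rotQuarter := by
  unfold rotQuarter
  fun_prop

theorem continuous_tableVel (ω : ℝ) : Continuous (tableVel ω) :=
  continuous_rotQuarter.const_smul ω

theorem continuous_inwardDir : Continuous fun x : Plane × ℝ => inwardDir x.1 x.2 := by
  have := continuous_rotQuarter
  unfold inwardDir
  fun_prop

theorem continuous_reflect (ω : ℝ) :
    Continuous fun x : Plane × Plane × ℝ => reflect ω x.1 x.2.1 x.2.2 := by
  have h1 := continuous_tableVel ω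
  have h2 := continuous_inwardDir
  have h3 : Continuous fun x : Plane × Plane × ℝ => inwardDir x.1 x.2.2 :=
    h2.comp (continuous_fst.prodMk (continuous_snd.comp continuous_snd))
  unfold reflect
  fun_prop

theorem continuous_startVel (ω w : ℝ) (p : Plane) : Continuous (startVel ω w p) := by
  have h3 : Continuous (inwardDir p) := by
    unfold inwardDir
    fun_prop
  have h4 : Continuous (startSpeed ω w) := by
    unfold startSpeed
    fun_prop
  exact continuous_const.add (h4.smul h3)

theorem continuous_flightPos (g : ℝ) :
    Continuous fun x : Plane × Plane × ℝ => flightPos g x.1 x.2.1 x.2.2 := by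
  unfold flightPos
  fun_prop

theorem continuous_flightVel (g : ℝ) :
    Continuous fun x : Plane × ℝ => flightVel g x.1 x.2 := by
  unfold flightVel
  fun_prop

/-! ### The vertical orbit -/

/-- The data of an orbit which bounces for ever on a vertical chord of the disc: the `n`-th flight
goes from `(a, b n)` to `(a, -b n)`, with vertical velocity `c n` at its beginning and `d n` at its
end, and does not turn round in between. The condition `next_vel` says that the collisions are
elastic bounces on a wall moving upwards with the velocity `ω a` of the table in the vertical
direction. -/
structure VerticalOrbit (ω g a : ℝ) (b c d : ℕ → ℝ) : Prop where
  on_circle : ∀ n, a ^ 2 + b n ^ 2 = 1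
  inward : ∀ n, b n * c n < 0
  same_sign : ∀ n, 0 < c n * d n
  energy : ∀ n, d n ^ 2 = c n ^ 2 + 4 * g * b n
  next_pos : ∀ n, b (n + 1) = -b n
  next_vel : ∀ n, c (n + 1) = 2 * (ω * a) - d n

namespace VerticalOrbit

variable {ω g a : ℝ} {b c d : ℕ → ℝ}

theorem norm_point_eq_one (h : VerticalOrbit ω g a b c d) (n : ℕ) : ‖(!₂[a, b n] : Plane)‖ = 1 := by
  rw [← sq_eq_sq₀ (norm_nonneg _) zero_le_one, plane_norm_sq]
  simpa using h.on_circle n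

/-- The orbit is realized by suitable reflection angles: the required outgoing velocity has, in the
rotating frame, the same norm as the incoming one and points into the disc. -/
theorem exists_reflect_eq (h : VerticalOrbit ω g a b c d) (n : ℕ) :
    ∃ φ ∈ Set.Ioo (-(Real.pi / 2)) (Real.pi / 2),
      reflect ω !₂[a, b (n + 1)] !₂[0, d n] φ = !₂[0, c (n + 1)] := by
  obtain ⟨-, φ, hφ, heq⟩ := exists_angle (ω := ω) (v := !₂[0, c (n + 1)])
    (h.norm_point_eq_one (n + 1)) (by simpa using h.inward (n + 1))
  have hnorm : ‖!₂[0, d n] - tableVel ω !₂[a, b (n + 1)]‖ =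
      ‖!₂[0, c (n + 1)] - tableVel ω !₂[a, b (n + 1)]‖ := by
    rw [← sq_eq_sq₀ (norm_nonneg _) (norm_nonneg _), plane_norm_sq, plane_norm_sq]
    simp [tableVel, rotQuarter, h.next_vel]
    ring
  refine ⟨φ, hφ, ?_⟩
  rw [reflect, hnorm, ← heq, add_sub_cancel]

theorem exists_startVel_eq (h : VerticalOrbit ω g a b c d) (hc : ω ^ 2 < c 0 ^ 2) :
    ∃ φ ∈ Set.Ioo (-(Real.pi / 2)) (Real.pi / 2),
      startVel ω (c 0 ^ 2) !₂[a, b 0] φ = !₂[0, c 0] := by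
  obtain ⟨hr, φ, hφ, heq⟩ := exists_angle (ω := ω) (v := !₂[0, c 0]) (h.norm_point_eq_one 0)
    (by simpa using h.inward 0)
  refine ⟨φ, hφ, (startVel_unique hc (h.norm_point_eq_one 0) φ hr heq ?_).symm⟩
  rw [plane_norm_sq]
  simp

open Filter Topology in
/-- If the angles `θ₀` realize the vertical orbit, then the trajectory depends continuously on the
angles at `θ₀` (and the particle stays on the unit circle at nearby reflections). -/
theorem tendsto_trajectory (h : VerticalOrbit ω g a b c d) (hg : 0 < g) {θ₀ : ℕ → ℝ}
    (hstart : startVel ω (c 0 ^ 2) !₂[a, b 0] (θ₀ 0) = !₂[0, c 0])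
    (hrefl : ∀ n, reflect ω !₂[a, b (n + 1)] !₂[0, d n] (θ₀ (n + 1)) = !₂[0, c (n + 1)]) (n : ℕ) :
    Tendsto (fun θ => ((trajectory ω g (c 0 ^ 2) !₂[a, b 0] θ n).pos,
        (trajectory ω g (c 0 ^ 2) !₂[a, b 0] θ n).vel)) (𝓝 θ₀) (𝓝 (!₂[a, b n], !₂[0, c n])) ∧
      ∀ᶠ θ in 𝓝 θ₀, ‖(trajectory ω g (c 0 ^ 2) !₂[a, b 0] θ n).pos‖ = 1 := by
  induction n with
  | zero =>
    refine ⟨?_, Eventually.of_forall fun θ => h.norm_point_eq_one 0⟩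
    refine tendsto_const_nhds.prodMk_nhds ?_
    rw [← hstart]
    exact ((continuous_startVel ω (c 0 ^ 2) !₂[a, b 0]).comp (continuous_apply 0)).tendsto θ₀
  | succ n ih =>
    obtain ⟨hlim, hone⟩ := ih
    obtain ⟨htime, hone'⟩ := tendsto_flightTime
      (vertical_time_pos hg (h.energy n) (h.inward n) (h.same_sign n))
      (exitFun_vertical_neg hg (h.energy n) (h.inward n) (h.same_sign n))
      (exitFun_vertical_pos hg (h.energy n) (h.inward n) (h.same_sign n)) hlim hone
    refine ⟨?_, hone'⟩
    have hq := ((continuous_flightPos g).tendsto (_, _, _)).comp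
      (hlim.fst_nhds.prodMk_nhds (hlim.snd_nhds.prodMk_nhds htime))
    have hv := ((continuous_flightVel g).tendsto (_, _)).comp (hlim.snd_nhds.prodMk_nhds htime)
    simp only [flightPos_vertical hg (h.energy n), ← h.next_pos n] at hq
    simp only [flightVel_vertical hg] at hv
    have hr := ((continuous_reflect ω).tendsto (_, _, _)).comp
      (hq.prodMk_nhds (hv.prodMk_nhds ((continuous_apply (n + 1)).tendsto θ₀)))
    simp only [hrefl n] at hr
    exact hq.prodMk_nhds hr

open Filter Topology in
theorem attainsEnergy_mem_nhds (h : VerticalOrbit ω g a b c d) (hg : 0 < g)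
    (hc : ω ^ 2 < c 0 ^ 2) :
    ∃ θ₀ : ℕ → ℝ, (∀ n, θ₀ n ∈ Set.Ioo (-(Real.pi / 2)) (Real.pi / 2)) ∧
      ∀ w₁ n, w₁ < c n ^ 2 → attainsEnergy ω g (c 0 ^ 2) !₂[a, b 0] w₁ ∈ 𝓝 θ₀ := by
  obtain ⟨φ₀, hφ₀, hstart⟩ := h.exists_startVel_eq hc
  choose φ hφ hrefl using h.exists_reflect_eq
  obtain ⟨θ₀, hzero, hsucc⟩ : ∃ θ₀ : ℕ → ℝ, θ₀ 0 = φ₀ ∧ ∀ n, θ₀ (n + 1) = φ n :=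
    ⟨fun n => Nat.casesOn n φ₀ φ, rfl, fun _ => rfl⟩
  refine ⟨θ₀, fun n => ?_, fun w₁ n hn => ?_⟩
  · cases n
    exacts [hzero ▸ hφ₀, hsucc _ ▸ hφ _]
  · rw [← hzero] at hstart
    simp only [← hsucc] at hrefl
    have hlim := (h.tendsto_trajectory hg hstart hrefl n).1
    have hsq := hlim.snd_nhds.norm.pow 2
    have hn' : w₁ < ‖(!₂[0, c n] : Plane)‖ ^ 2 := by
      rw [plane_norm_sq]
      simpa using hn
    filter_upwards [hsq.eventually (lt_mem_nhds hn')] with θ hθ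
    refine ⟨n, 0, le_rfl, Real.sInf_nonneg fun t ht => ht.1.le, ?_⟩
    simpa [flightVel] using hθ.le

end VerticalOrbit

/-! ### Open sets of angles have positive probability -/

theorem lambertian_pos_of_isOpen {U : Set ℝ} (hU : IsOpen U) {x : ℝ} (hxU : x ∈ U)
    (hx : x ∈ Set.Ioo (-(Real.pi / 2)) (Real.pi / 2)) : 0 < lambertian U := by
  have hV : IsOpen (U ∩ Set.Ioo (-(Real.pi / 2)) (Real.pi / 2)) := hU.inter isOpen_Ioo
  rw [pos_iff_ne_zero, lambertian, Ne, withDensity_apply_eq_zero' (by fun_prop)]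
  rw [Measure.restrict_apply' measurableSet_Ioo]
  refine ((hV.measure_pos volume ⟨x, hxU, hx⟩).trans_le (measure_mono fun y hy => ?_)).ne'
  refine ⟨⟨?_, hy.1⟩, hy.2⟩
  have := Real.cos_pos_of_mem_Ioo hy.2
  simpa using this

open Topology in
theorem lambertianAngles_pos_of_mem_nhds {S : Set (ℕ → ℝ)} {θ₀ : ℕ → ℝ} (hS : S ∈ 𝓝 θ₀)
    (hθ₀ : ∀ n, θ₀ n ∈ Set.Ioo (-(Real.pi / 2)) (Real.pi / 2)) : 0 < lambertianAngles S := by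
  obtain ⟨V, hVS, hVo, hV⟩ := mem_nhds_iff.1 hS
  obtain ⟨I, u, hu, huV⟩ := isOpen_pi_iff.1 hVo θ₀ hV
  refine lt_of_lt_of_le ?_ (measure_mono (huV.trans hVS))
  rw [lambertianAngles, Measure.infinitePi_pi _ fun i hi => (hu i hi).1.measurableSet]
  rw [pos_iff_ne_zero, Finset.prod_ne_zero_iff]
  exact fun i hi => (lambertian_pos_of_isOpen (hu i hi).1 (hu i hi).2 (hθ₀ i)).ne'

/-! ### Unbounded growth of the speed -/

/-- The upward speed at the lower end of a vertical chord after one more round trip; `C` is the loss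
of squared speed on the way up, and `K` is the speed lost in the bounce at the upper end and gained
in the one at the lower end. -/
noncomputable def roundTrip (K C V : ℝ) : ℝ := K + √((√(V ^ 2 - C) - K) ^ 2 + C)

theorem continuous_roundTrip (K C : ℝ) : Continuous (roundTrip K C) := by
  unfold roundTrip
  fun_prop

/-- A round trip gains speed, since `x ↦ √(x ^ 2 + C)` is a strict contraction. -/
theorem lt_roundTrip {K C V : ℝ} (hK : 0 < K) (hC : 0 < C) (hV : 0 < V)
    (hKV : K ^ 2 + C < V ^ 2) : V < roundTrip K C V := by
  have h1 : √(V ^ 2 - C) ^ 2 = V ^ 2 - C := Real.sq_sqrt (by nlinarith)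
  have h2 : K < √(V ^ 2 - C) := Real.lt_sqrt_of_sq_lt (by linarith)
  have h3 : √(V ^ 2 - C) < V := by
    rw [Real.sqrt_lt' hV]
    linarith
  unfold roundTrip
  set X := √(V ^ 2 - C)
  have : V - K < √((X - K) ^ 2 + C) := by
    apply Real.lt_sqrt_of_sq_lt
    nlinarith
  linarith

theorem iterate_roundTrip_ge {K C V₀ : ℝ} (hK : 0 < K) (hC : 0 < C) (hV₀ : 0 < V₀)
    (h₀ : K ^ 2 + C < V₀ ^ 2) (n : ℕ) : V₀ ≤ (roundTrip K C)^[n] V₀ := by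
  induction n with
  | zero => exact le_rfl
  | succ n ih =>
    rw [Function.iterate_succ_apply']
    exact ih.trans (lt_roundTrip hK hC (hV₀.trans_le ih) (h₀.trans_le (by gcongr))).le

open Filter Topology in
/-- The speed after `n` round trips is unbounded: otherwise it would converge to a fixed point of
`roundTrip`. -/
theorem tendsto_iterate_roundTrip {K C V₀ : ℝ} (hK : 0 < K) (hC : 0 < C) (hV₀ : 0 < V₀)
    (h₀ : K ^ 2 + C < V₀ ^ 2) : Tendsto (fun n => (roundTrip K C)^[n] V₀) atTop atTop := by
  have hge := iterate_roundTrip_ge hK hC hV₀ h₀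
  have hlt : ∀ x, V₀ ≤ x → x < roundTrip K C x := fun x hx =>
    lt_roundTrip hK hC (hV₀.trans_le hx) (h₀.trans_le (by gcongr))
  have hmono : Monotone fun n => (roundTrip K C)^[n] V₀ := by
    refine monotone_nat_of_le_succ fun n => ?_
    rw [Function.iterate_succ_apply']
    exact (hlt _ (hge n)).le
  refine (tendsto_atTop_of_monotone hmono).resolve_right ?_
  rintro ⟨L, hL⟩
  have hfix := isFixedPt_of_tendsto_iterate hL (continuous_roundTrip K C).continuousAt
  exact (hlt L (ge_of_tendsto' hL hge)).ne' hfix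

/-- The vertical orbit on the chord with abscissa `3 / 5`, started upwards from the lower end with
speed `V₀`. -/
theorem exists_verticalOrbit {ω g V₀ : ℝ} (hω : 0 < ω) (hg : 0 < g) (hV₀ : 0 < V₀)
    (h₀ : (6 / 5 * ω) ^ 2 + 16 / 5 * g < V₀ ^ 2) :
    ∃ b c d : ℕ → ℝ, VerticalOrbit ω g (3 / 5) b c d ∧ c 0 = V₀ ∧
      ∀ k, c (2 * k) = (roundTrip (6 / 5 * ω) (16 / 5 * g))^[k] V₀ := by
  obtain ⟨K, hKdef⟩ : ∃ K, K = 6 / 5 * ω := ⟨_, rfl⟩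
  obtain ⟨C, hCdef⟩ : ∃ C, C = 16 / 5 * g := ⟨_, rfl⟩
  rw [← hKdef, ← hCdef] at h₀ ⊢
  have hK : 0 < K := by rw [hKdef]; positivity
  have hC : 0 < C := by rw [hCdef]; positivity
  have hge := iterate_roundTrip_ge hK hC hV₀ h₀
  obtain ⟨V, hV⟩ : ∃ V : ℕ → ℝ, V = fun n => (roundTrip K C)^[n] V₀ := ⟨_, rfl⟩
  have hVpos : ∀ n, 0 < V n := fun n => by rw [hV]; exact hV₀.trans_le (hge n)
  have hVK : ∀ n, K ^ 2 + C < V n ^ 2 := fun n => by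
    rw [hV]; exact h₀.trans_le (pow_le_pow_left₀ hV₀.le (hge n) 2)
  have hVsucc : ∀ n, V (n + 1) = K + √((√(V n ^ 2 - C) - K) ^ 2 + C) := fun n => by
    simp only [hV]; rw [Function.iterate_succ_apply', roundTrip]
  have hup : ∀ n, K < √(V n ^ 2 - C) := fun n => Real.lt_sqrt_of_sq_lt (by linarith [hVK n])
  have hupsq : ∀ n, √(V n ^ 2 - C) ^ 2 = V n ^ 2 - C := fun n =>
    Real.sq_sqrt (by nlinarith [hVK n])
  have hdown : ∀ n, 0 < √((√(V n ^ 2 - C) - K) ^ 2 + C) := fun n => Real.sqrt_pos.2 (by positivity)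
  have hdownsq : ∀ n, √((√(V n ^ 2 - C) - K) ^ 2 + C) ^ 2 = (√(V n ^ 2 - C) - K) ^ 2 + C :=
    fun n => Real.sq_sqrt (by positivity)
  have hKe : 2 * (ω * (3 / 5)) = K := by rw [hKdef]; ring
  -- even flights go upwards and odd ones downwards
  refine ⟨fun n => if Even n then -(4 / 5) else 4 / 5,
    fun n => if Even n then V (n / 2) else K - √(V (n / 2) ^ 2 - C),
    fun n => if Even n then √(V (n / 2) ^ 2 - C) else -√((√(V (n / 2) ^ 2 - C) - K) ^ 2 + C),
    ⟨fun n => ?_, fun n => ?_, fun n => ?_, fun n => ?_, fun n => ?_, fun n => ?_⟩,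
    by simp [hV], fun k => by simp [hV]⟩
  · by_cases hn : Even n <;> simp only [hn, if_true, if_false] <;> norm_num
  · by_cases hn : Even n <;> simp only [hn, if_true, if_false]
    · linarith [hVpos (n / 2)]
    · linarith [hup (n / 2)]
  · by_cases hn : Even n <;> simp only [hn, if_true, if_false]
    · exact mul_pos (hVpos _) (hK.trans (hup _))
    · exact mul_pos_of_neg_of_neg (by linarith [hup (n / 2)]) (by linarith [hdown (n / 2)])
  · by_cases hn : Even n <;> simp only [hn, if_true, if_false]
    · rw [hupsq, hCdef]; ring
    · rw [neg_sq, hdownsq, hCdef]; ring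
  · by_cases hn : Even n <;> simp [hn, Nat.even_add_one]
  · by_cases hn : Even n
    · have h2 : (n + 1) / 2 = n / 2 := by obtain ⟨k, rfl⟩ := hn; omega
      simp only [hn, Nat.even_add_one, not_true, if_true, if_false, h2, hKe]
    · have h2 : (n + 1) / 2 = n / 2 + 1 := by
        obtain ⟨k, rfl⟩ := Nat.not_even_iff_odd.1 hn; omega
      simp only [hn, Nat.even_add_one, not_false_eq_true, if_true, if_false, h2, hKe, hVsucc]
      ring

/-! ### The energy is unbounded with positive probability -/

theorem mainTheorem10 (ω g : ℝ) (hω : 0 < ω) (hg : 0 < g) :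
    ∃ w₀ : ℝ, ω ^ 2 < w₀ ∧ ∃ p₁ : Plane, ‖p₁‖ = 1 ∧
      ∀ w₁ : ℝ, w₀ < w₁ → ∃ ε : ℝ, 0 < ε ∧
        ε < lambertianAngles.real (attainsEnergy ω g w₀ p₁ w₁) := by
  have hV₀ : 0 < 6 / 5 * ω + 16 / 5 * g + 1 := by positivity
  have h₀ : (6 / 5 * ω) ^ 2 + 16 / 5 * g < (6 / 5 * ω + 16 / 5 * g + 1) ^ 2 := by
    nlinarith [mul_pos hω hg]
  obtain ⟨b, c, d, h, hc0, hc⟩ := exists_verticalOrbit hω hg hV₀ h₀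
  have hw : ω ^ 2 < c 0 ^ 2 := by
    rw [hc0]
    gcongr
    linarith
  obtain ⟨θ₀, hθ₀, hmem⟩ := h.attainsEnergy_mem_nhds hg hw
  refine ⟨c 0 ^ 2, hw, !₂[3 / 5, b 0], h.norm_point_eq_one 0, fun w₁ _ => ?_⟩
  have hlim := tendsto_iterate_roundTrip (by positivity) (by positivity) hV₀ h₀
  obtain ⟨k, hk1, hk2⟩ := ((hlim.eventually_gt_atTop w₁).and (hlim.eventually_ge_atTop 1)).exists
  have hpos := lambertianAngles_pos_of_mem_nhds (hmem w₁ (2 * k) (by rw [hc]; nlinarith)) hθ₀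
  have hreal : 0 < lambertianAngles.real
      (attainsEnergy ω g (c 0 ^ 2) !₂[3 / 5, b 0] w₁) := by
    refine ENNReal.toReal_pos hpos.ne' ?_
    rw [lambertianAngles]
    exact measure_ne_top _ _
  exact ⟨_, half_pos hreal, half_lt_self hreal⟩
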